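/- Let $n\ge 1$, and consider $n$ men and $n$ women. Each man ranks all $n$ women in a strict preference list, and each woman ranks all $n$ men in a strict preference list; the instance formed by these $2n$ lists is chosen uniformly at random among all $(n!)^{2n}$ instances. A matching is a bijection $M$ from the set of men to the set of women. A matching is called exchange-stable if there are no two distinct men each of whom prefers the other's wife under $M$ to his own wife, and no two distinct women each of whom prefers the other's husband under $M$ to her own husband. Let $S_n$ be the number of exchange-stable matchings of the random instance. Then for every real $\sigma<1/3$, $$\mathrm{E}[S_n]=\bigl(1+O(n^{-\sigma})\bigr)\sqrt{\frac{\pi n}{2}}\qquad (n\to\infty),$$ where the constant implied by $O(\cdot)$ may depend on $\sigma$. -/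

import Mathlib

open Filter Asymptotics

/-- An instance of the two-sided matching problem with `n` men and `n` women, both labelled by
`Fin n`. The first component gives, for every man `i`, his strict ranking of the women: the woman
`j` occupies position `P.1 i j` in his list, and a smaller position is better. The second component
gives, for every woman `j`, her ranking of the men. There are `(n!) ^ (2 * n)` instances. -/
abbrev PrefInstance (n : ℕ) : Type :=
  (Fin n → Equiv.Perm (Fin n)) × (Fin n → Equiv.Perm (Fin n))

theorem card_prefInstance (n : ℕ) :
    Fintype.card (PrefInstance n) = n.factorial ^ (2 * n) := by
  simp [PrefInstance, Fintype.card_perm, two_mul, pow_add]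

/-- Two men `i₁`, `i₂` block the matching `M` (a bijection from men to women) if each of them
prefers the other one's wife to his own wife. -/
def MenBlock {n : ℕ} (P : PrefInstance n) (M : Equiv.Perm (Fin n)) (i₁ i₂ : Fin n) : Prop :=
  P.1 i₁ (M i₂) < P.1 i₁ (M i₁) ∧ P.1 i₂ (M i₁) < P.1 i₂ (M i₂)

/-- Two women `j₁`, `j₂` block the matching `M` if each of them prefers the other one's husband to
her own husband. -/
def WomenBlock {n : ℕ} (P : PrefInstance n) (M : Equiv.Perm (Fin n)) (j₁ j₂ : Fin n) : Prop :=
  P.2 j₁ (M.symm j₂) < P.2 j₁ (M.symm j₁) ∧ P.2 j₂ (M.symm j₁) < P.2 j₂ (M.symm j₂)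

/-- A matching is exchange-stable if no two men block it and no two women block it. -/
def IsExchangeStable {n : ℕ} (P : PrefInstance n) (M : Equiv.Perm (Fin n)) : Prop :=
  (∀ i₁ i₂ : Fin n, i₁ ≠ i₂ → ¬ MenBlock P M i₁ i₂) ∧
    (∀ j₁ j₂ : Fin n, j₁ ≠ j₂ → ¬ WomenBlock P M j₁ j₂)

instance {n : ℕ} (P : PrefInstance n) : DecidablePred (IsExchangeStable P) := fun M => by
  unfold IsExchangeStable MenBlock WomenBlock
  infer_instance

/-- The number `S_n` of exchange-stable matchings of an instance. -/
def numExchangeStable {n : ℕ} (P : PrefInstance n) : ℕ :=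
  (Finset.univ.filter (fun M : Equiv.Perm (Fin n) => IsExchangeStable P M)).card

/-- The expectation `E[S_n]` when the instance is uniformly distributed over all
`(n!) ^ (2 * n)` instances. -/
noncomputable def expectedExchangeStable (n : ℕ) : ℝ :=
  (∑ P : PrefInstance n, (numExchangeStable P : ℝ)) / (Fintype.card (PrefInstance n) : ℝ)

open MeasureTheory Set
open scoped ENNReal

/-! Relabelling by `M` makes the men's and women's conditions independent and equally likely, so
`E[S_n] = n! p²`, where `p` is the probability that no two agents on one side want to exchange.
Inclusion–exclusion over graphs, together with `1/(d+1) = ∫₀¹ t^d`, turns `p` into the integral of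
`∏_{i<j} (1 - xᵢxⱼ)` over the unit cube (`card_exchangeFree_div_eq_integral`).

Write `s = ∑ xᵢ` and `U = ∑ xᵢ²`. Taking logarithms, the integrand is `exp(-s²/2)` times about
`exp(U(2-U)/4)`, up to fourth powers of coordinates and sums of `xᵢ³xⱼ³`. Dirichlet's formula gives
every moment of the weight `exp(-s²/2)` on the positive orthant exactly. Under the normalised weight
`U` concentrates at 2, so the correction averages to `1 + O(n^{-1/2})`
(`abs_indicator_unitCube_sub_sumWeight_le`, `hasOrthantMean_errorBound`).

Hence `p` is the total mass of the weight up to that factor. The duplication formula and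
log-convexity of Gamma evaluate `n!` times the squared mass (`exists_factorial_mul_orthantMass_sq`).
The resulting rate `n^{-1/2}` is stronger than needed. -/

/-! ### Inclusion–exclusion for the one-sided condition -/

/-- The pairs of indices `i < j`. -/
def orderedPairs (n : ℕ) : Finset (Fin n × Fin n) :=
  Finset.univ.filter fun e => e.1 < e.2

/-- The neighbours of `i` in the graph with edge set `E`. -/
def edgeNeighbors {n : ℕ} (E : Finset (Fin n × Fin n)) (i : Fin n) : Finset (Fin n) :=
  Finset.univ.filter fun j => (i, j) ∈ E ∨ (j, i) ∈ E

theorem not_mem_edgeNeighbors_self {n : ℕ} {E : Finset (Fin n × Fin n)}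
    (hE : E ⊆ orderedPairs n) (i : Fin n) : i ∉ edgeNeighbors E i := by
  intro h
  simp only [edgeNeighbors, Finset.mem_filter, Finset.mem_univ, true_and, or_self] at h
  simpa [orderedPairs] using hE h

/-- An edge contributes one factor at each endpoint; orientation `i < j` prevents double counting.
-/
theorem prod_edges_eq_prod_edgeNeighbors {R : Type*} [CommRing R] {n : ℕ}
    {E : Finset (Fin n × Fin n)} (hE : E ⊆ orderedPairs n) (a : Fin n → Fin n → R) :
    ∏ e ∈ E, (a e.1 e.2 * a e.2 e.1) = ∏ i, ∏ j ∈ edgeNeighbors E i, a i j := by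
  have hite : ∀ f : Fin n → Fin n → R,
      ∏ e ∈ E, f e.1 e.2 = ∏ i, ∏ j, if (i, j) ∈ E then f i j else 1 := by
    intro f
    rw [← Fintype.prod_prod_type' (fun i j => if (i, j) ∈ E then f i j else 1)]
    simp [Finset.prod_ite_mem]
  rw [Finset.prod_mul_distrib, hite a, hite fun i j => a j i,
    Finset.prod_comm (f := fun i j => if (i, j) ∈ E then a j i else 1),
    ← Finset.prod_mul_distrib]
  refine Finset.prod_congr rfl fun i _ => ?_
  rw [← Finset.prod_mul_distrib, edgeNeighbors, Finset.prod_filter]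
  refine Finset.prod_congr rfl fun j _ => ?_
  have hex : (i, j) ∈ E → (j, i) ∉ E := fun h1 h2 => by
    have h3 := hE h1
    have h4 := hE h2
    simp only [orderedPairs, Finset.mem_filter, Finset.mem_univ, true_and] at h3 h4
    exact lt_asymm h3 h4
  by_cases h1 : (i, j) ∈ E
  · simp [h1, hex h1]
  · by_cases h2 : (j, i) ∈ E <;> simp [h1, h2]

theorem prod_one_sub_orderedPairs {R : Type*} [CommRing R] {n : ℕ} (a : Fin n → Fin n → R) :
    ∏ e ∈ orderedPairs n, (1 - a e.1 e.2 * a e.2 e.1) =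
      ∑ E ∈ (orderedPairs n).powerset,
        (-1) ^ E.card * ∏ i, ∏ j ∈ edgeNeighbors E i, a i j := by
  simp_rw [sub_eq_add_neg]
  rw [Finset.prod_one_add]
  refine Finset.sum_congr rfl fun E hE => ?_
  rw [Finset.prod_neg, prod_edges_eq_prod_edgeNeighbors (Finset.mem_powerset.1 hE)]

/-- By symmetry each element of `insert i S` is equally likely to have the largest position: the
events `A t` partition all permutations, and composing with `swap i t` shows they have equal size.
-/
theorem card_perm_forall_lt {n : ℕ} (i : Fin n) (S : Finset (Fin n)) (hi : i ∉ S) :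
    (S.card + 1) * (Finset.univ.filter fun p : Equiv.Perm (Fin n) => ∀ j ∈ S, p j < p i).card =
      n.factorial := by
  classical
  let A : Fin n → Finset (Equiv.Perm (Fin n)) := fun t =>
    Finset.univ.filter fun p => ∀ j ∈ insert i S, j ≠ t → p j < p t
  have hA : ∀ t ∈ insert i S, (A t).card =
      (Finset.univ.filter fun p : Equiv.Perm (Fin n) => ∀ j ∈ S, p j < p i).card := by
    intro t ht
    have hmem : ∀ j, j ∈ insert i S → Equiv.swap i t j ∈ insert i S := by
      intro j hj
      by_cases h1 : j = i
      · subst h1; simpa using ht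
      · by_cases h2 : j = t
        · subst h2; simp
        · rwa [Equiv.swap_apply_of_ne_of_ne h1 h2]
    refine Finset.card_equiv (Equiv.mulRight (Equiv.swap i t)) fun p => ?_
    simp only [A, Finset.mem_filter, Finset.mem_univ, true_and, Equiv.coe_mulRight,
      Equiv.Perm.mul_apply, Equiv.swap_apply_left]
    constructor
    · intro h j hj
      refine h _ (hmem j (Finset.mem_insert_of_mem hj)) fun h' => ?_
      rw [Equiv.swap_apply_eq_iff, Equiv.swap_apply_right] at h'
      exact hi (h' ▸ hj)
    · intro h j hj hjt
      have h1 := hmem j hj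
      have h2 : Equiv.swap i t j ≠ i := by
        rw [Ne, Equiv.swap_apply_eq_iff, Equiv.swap_apply_left]; exact hjt
      simpa using h _ (Finset.mem_of_mem_insert_of_ne h1 h2)
  have hU : (insert i S).biUnion A = Finset.univ := by
    refine Finset.eq_univ_of_forall fun p => ?_
    obtain ⟨t, ht, hmax⟩ := Finset.exists_max_image (insert i S) p ⟨i, Finset.mem_insert_self i S⟩
    refine Finset.mem_biUnion.2 ⟨t, ht, ?_⟩
    simp only [A, Finset.mem_filter, Finset.mem_univ, true_and]
    exact fun j hj hjt => lt_of_le_of_ne (hmax j hj) (p.injective.ne hjt)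
  have hD : ∀ t ∈ insert i S, ∀ u ∈ insert i S, t ≠ u → Disjoint (A t) (A u) := by
    intro t ht u hu htu
    refine Finset.disjoint_left.2 fun p h1 h2 => ?_
    simp only [A, Finset.mem_filter, Finset.mem_univ, true_and] at h1 h2
    exact lt_asymm (h1 u hu htu.symm) (h2 t ht htu)
  have := Finset.card_biUnion hD
  rw [hU, Finset.sum_congr rfl hA, Finset.sum_const, Finset.card_univ, Fintype.card_perm,
    Fintype.card_fin, Finset.card_insert_of_notMem hi, smul_eq_mul] at this
  exact this.symm

/-- The set of one-sided preference systems for which no two agents want to exchange the partners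
that the identity matching assigns to them. -/
def exchangeFree (n : ℕ) : Finset (Fin n → Equiv.Perm (Fin n)) :=
  Finset.univ.filter fun p => ∀ i j : Fin n, i ≠ j → ¬ (p i j < p i i ∧ p j i < p j j)

theorem card_filter_isExchangeStable {n : ℕ} (M : Equiv.Perm (Fin n)) :
    (Finset.univ.filter fun P : PrefInstance n => IsExchangeStable P M).card =
      (exchangeFree n).card ^ 2 := by
  rw [sq, ← Finset.card_product]
  -- Men's lists are composed with `M`, women are renamed by their husbands; both sides then refer
  -- to the identity matching.
  refine Finset.card_equiv (Equiv.prodCongr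
    (Equiv.piCongrRight fun _ => Equiv.mulRight M :
      (Fin n → Equiv.Perm (Fin n)) ≃ (Fin n → Equiv.Perm (Fin n)))
    (Equiv.arrowCongr M.symm (Equiv.refl _))) fun P => ?_
  simp only [exchangeFree, Finset.mem_filter, Finset.mem_univ, true_and, Finset.mem_product]
  refine and_congr Iff.rfl ⟨fun h i j hij => ?_, fun h i j hij => ?_⟩
  · simpa [WomenBlock] using h (M i) (M j) (M.injective.ne hij)
  · simpa [WomenBlock] using h (M.symm i) (M.symm j) (M.symm.injective.ne hij)

theorem expectedExchangeStable_eq (n : ℕ) :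
    expectedExchangeStable n =
      n.factorial * ((exchangeFree n).card / (n.factorial : ℝ) ^ n) ^ 2 := by
  have h : ∑ P : PrefInstance n, numExchangeStable P =
      n.factorial * (exchangeFree n).card ^ 2 := by
    simp_rw [numExchangeStable, Finset.card_filter]
    rw [Finset.sum_comm]
    simp_rw [← Finset.card_filter, card_filter_isExchangeStable]
    simp [Fintype.card_perm]
  rw [expectedExchangeStable, ← Nat.cast_sum, h, card_prefInstance]
  push_cast
  rw [div_pow, ← pow_mul, mul_comm n 2, mul_div_assoc]

/-- Once the edge set is fixed, the rankings of different agents are independent, so the probability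
factors over vertices. -/
theorem card_exchangeFree_div (n : ℕ) :
    ((exchangeFree n).card : ℝ) / (n.factorial : ℝ) ^ n =
      ∑ E ∈ (orderedPairs n).powerset,
        (-1) ^ E.card * ∏ i, (1 : ℝ) / ((edgeNeighbors E i).card + 1) := by
  have h1 : ((exchangeFree n).card : ℝ) = ∑ p : Fin n → Equiv.Perm (Fin n),
      ∏ e ∈ orderedPairs n, (1 - (if p e.1 e.2 < p e.1 e.1 then (1 : ℝ) else 0) *
        if p e.2 e.1 < p e.2 e.2 then (1 : ℝ) else 0) := by
    rw [exchangeFree, Finset.card_filter, Nat.cast_sum]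
    refine Finset.sum_congr rfl fun p _ => ?_
    by_cases hp : ∀ i j : Fin n, i ≠ j → ¬ (p i j < p i i ∧ p j i < p j j)
    · rw [if_pos hp, Nat.cast_one, Finset.prod_eq_one]
      intro e he
      have hlt : e.1 < e.2 := by simpa [orderedPairs] using he
      have := hp e.1 e.2 hlt.ne
      by_cases h1 : p e.1 e.2 < p e.1 e.1
      · rw [if_neg fun h2 => this ⟨h1, h2⟩, mul_zero, sub_zero]
      · simp [h1]
    · rw [if_neg hp, Nat.cast_zero]
      push Not at hp
      obtain ⟨i, j, hij, h1, h2⟩ := hp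
      rcases lt_or_gt_of_ne hij with h | h
      · exact (Finset.prod_eq_zero (i := (i, j)) (by simpa [orderedPairs] using h)
          (by simp [h1, h2])).symm
      · exact (Finset.prod_eq_zero (i := (j, i)) (by simpa [orderedPairs] using h)
          (by simp [h1, h2])).symm
  rw [h1]
  simp_rw [fun p : Fin n → Equiv.Perm (Fin n) =>
    prod_one_sub_orderedPairs fun i j => if p i j < p i i then (1 : ℝ) else 0]
  rw [Finset.sum_comm, Finset.sum_div]
  refine Finset.sum_congr rfl fun E hE => ?_
  rw [← Finset.mul_sum, mul_div_assoc]
  congr 1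
  rw [← Fintype.prod_sum fun (i : Fin n) (q : Equiv.Perm (Fin n)) =>
    ∏ j ∈ edgeNeighbors E i, if q j < q i then (1 : ℝ) else 0]
  have h2 : (n.factorial : ℝ) ^ n = ∏ _i : Fin n, (n.factorial : ℝ) := by simp
  rw [h2, ← Finset.prod_div_distrib]
  refine Finset.prod_congr rfl fun i _ => ?_
  have h3 := card_perm_forall_lt i _ (not_mem_edgeNeighbors_self (Finset.mem_powerset.1 hE) i)
  simp_rw [Finset.prod_ite_zero, Finset.prod_const_one]
  rw [← Nat.cast_inj (R := ℝ)] at h3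
  rw [Finset.sum_boole, div_eq_div_iff (by positivity) (by positivity), ← h3]
  push_cast
  ring

/-! ### The integral over the cube -/

/-- The half-open unit cube. -/
def unitCube (n : ℕ) : Set (Fin n → ℝ) := univ.pi fun _ => Ioc 0 1

theorem measurableSet_unitCube (n : ℕ) : MeasurableSet (unitCube n) :=
  MeasurableSet.univ_pi fun _ => measurableSet_Ioc

theorem card_exchangeFree_div_eq_integral (n : ℕ) :
    ((exchangeFree n).card : ℝ) / (n.factorial : ℝ) ^ n =
      ∫ x in unitCube n, ∏ e ∈ orderedPairs n, (1 - x e.1 * x e.2) := by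
  rw [card_exchangeFree_div]
  simp_rw [fun x : Fin n → ℝ => prod_one_sub_orderedPairs fun i _ => x i, Finset.prod_const]
  simp_rw [unitCube, volume_pi, Measure.restrict_pi_pi]
  rw [integral_finsetSum]
  · refine Finset.sum_congr rfl fun E _ => ?_
    rw [integral_const_mul,
      integral_fintype_prod_eq_prod (fun i (t : ℝ) => t ^ (edgeNeighbors E i).card)]
    congr 1
    refine Finset.prod_congr rfl fun i _ => ?_
    rw [← intervalIntegral.integral_of_le zero_le_one, integral_pow]
    simp
  · intro E _
    refine Integrable.const_mul (Integrable.fintype_prod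
      (f := fun i (t : ℝ) => t ^ (edgeNeighbors E i).card) fun i => ?_) _
    exact (Continuous.integrableOn_Icc (by fun_prop)).mono_set Ioc_subset_Icc_self

/-! ### Beta and Dirichlet integrals -/

theorem integral_pow_mul_sub_pow (a b : ℕ) (r : ℝ) :
    ∫ t in (0 : ℝ)..r, t ^ a * (r - t) ^ b =
      (a.factorial * b.factorial : ℝ) / (a + b + 1).factorial * r ^ (a + b + 1) := by
  induction a generalizing b with
  | zero =>
    have h : ∀ t ∈ uIcc 0 r, HasDerivAt (fun t : ℝ => -((r - t) ^ (b + 1) / (b + 1)))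
        (t ^ 0 * (r - t) ^ b) t := by
      intro t _
      have := ((((hasDerivAt_id t).const_sub r).pow (b + 1)).div_const ((b : ℝ) + 1)).neg
      refine this.congr_deriv ?_
      have : (b : ℝ) + 1 ≠ 0 := by positivity
      push_cast
      simp only [id]
      field_simp
    rw [intervalIntegral.integral_eq_sub_of_hasDerivAt h
      (Continuous.intervalIntegrable (by fun_prop) _ _)]
    have : (b : ℝ) + 1 ≠ 0 := by positivity
    have : (b.factorial : ℝ) ≠ 0 := by positivity
    simp only [zero_add, Nat.factorial_succ]
    push_cast
    field_simp
    simp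
  | succ a ih =>
    have h : ∀ t ∈ uIcc 0 r, HasDerivAt (fun t : ℝ => t ^ (a + 1) * (r - t) ^ (b + 1))
        ((a + 1) * (t ^ a * (r - t) ^ (b + 1)) - (b + 1) * (t ^ (a + 1) * (r - t) ^ b)) t := by
      intro t _
      have := ((hasDerivAt_id t).pow (a + 1)).mul (((hasDerivAt_id t).const_sub r).pow (b + 1))
      refine this.congr_deriv ?_
      push_cast
      simp only [id, Pi.pow_apply]
      ring
    have h1 := intervalIntegral.integral_eq_sub_of_hasDerivAt h
      (Continuous.intervalIntegrable (by fun_prop) _ _)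
    rw [intervalIntegral.integral_sub (Continuous.intervalIntegrable (by fun_prop) _ _)
      (Continuous.intervalIntegrable (by fun_prop) _ _),
      intervalIntegral.integral_const_mul, intervalIntegral.integral_const_mul, ih] at h1
    simp only [sub_self, ne_eq, Nat.add_eq_zero_iff, one_ne_zero, and_false, not_false_eq_true,
      zero_pow, mul_zero, zero_mul] at h1
    have hb : (b : ℝ) + 1 ≠ 0 := by positivity
    rw [eq_comm, ← mul_right_inj' hb, ← sub_eq_zero.1 h1]
    have e : a + 1 + b + 1 = a + (b + 1) + 1 := by ring
    rw [e, Nat.factorial_succ a, Nat.factorial_succ b]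
    push_cast
    ring

theorem lintegral_pow_mul_lintegral_pow_mul (a b : ℕ) {g : ℝ → ℝ≥0∞} (hg : Measurable g) :
    ∫⁻ t in Ioi (0 : ℝ), ENNReal.ofReal (t ^ a) *
        ∫⁻ s in Ioi (0 : ℝ), ENNReal.ofReal (s ^ b) * g (t + s) =
      ENNReal.ofReal ((a.factorial * b.factorial : ℝ) / (a + b + 1).factorial) *
        ∫⁻ r in Ioi (0 : ℝ), ENNReal.ofReal (r ^ (a + b + 1)) * g r := by
  -- The integrand in coordinates `(t, r)` with `r = t + s`; the indicators extend it to the whole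
  -- plane so that Tonelli applies, leaving a Beta integral in `t`.
  let F : ℝ → ℝ → ℝ≥0∞ := fun t r =>
    (Ioi (0 : ℝ)).indicator 1 t * (Ioi (0 : ℝ)).indicator 1 (r - t) *
      ENNReal.ofReal (t ^ a * (r - t) ^ b) * g r
  have hI : Measurable ((Ioi (0 : ℝ)).indicator (1 : ℝ → ℝ≥0∞)) :=
    measurable_one.indicator measurableSet_Ioi
  have hF : Measurable (Function.uncurry F) := by
    refine Measurable.mul (Measurable.mul (Measurable.mul ?_ ?_) ?_) ?_
    · exact hI.comp measurable_fst
    · exact hI.comp (measurable_snd.sub measurable_fst)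
    · fun_prop
    · exact hg.comp measurable_snd
  have hL : ∫⁻ t in Ioi (0 : ℝ), ENNReal.ofReal (t ^ a) *
        ∫⁻ s in Ioi (0 : ℝ), ENNReal.ofReal (s ^ b) * g (t + s) = ∫⁻ t, ∫⁻ r, F t r := by
    rw [← lintegral_indicator measurableSet_Ioi]
    refine lintegral_congr fun t => ?_
    by_cases ht : t ∈ Ioi (0 : ℝ)
    · rw [indicator_of_mem ht, ← lintegral_indicator measurableSet_Ioi,
        ← lintegral_sub_right_eq_self _ t, ← lintegral_const_mul']
      · refine lintegral_congr fun r => ?_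
        by_cases hr : r - t ∈ Ioi (0 : ℝ)
        · simp only [F, indicator_of_mem ht, indicator_of_mem hr, Pi.one_apply, one_mul]
          rw [ENNReal.ofReal_mul (pow_nonneg (le_of_lt ht) _), mul_assoc, add_sub_cancel]
        · simp [F, indicator_of_notMem hr]
      · exact ENNReal.ofReal_ne_top
    · simp [F, indicator_of_notMem ht]
  rw [hL, lintegral_lintegral_swap hF.aemeasurable, ← lintegral_const_mul _ (by fun_prop),
    ← lintegral_indicator measurableSet_Ioi]
  refine lintegral_congr fun r => ?_
  by_cases hr : r ∈ Ioi (0 : ℝ)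
  · have hr0 : (0 : ℝ) < r := hr
    rw [indicator_of_mem hr]
    have h1 : ∀ t, F t r = (Ioo 0 r).indicator
        (fun t => ENNReal.ofReal (t ^ a * (r - t) ^ b)) t * g r := by
      intro t
      simp only [F]
      by_cases h1 : 0 < t <;> by_cases h2 : t < r <;> simp [indicator, h1, h2]
    simp_rw [h1]
    rw [lintegral_mul_const _ (by measurability), lintegral_indicator measurableSet_Ioo,
      ← mul_assoc, ← ENNReal.ofReal_mul (by positivity), ← integral_pow_mul_sub_pow,
      intervalIntegral.integral_of_le hr0.le, integral_Ioc_eq_integral_Ioo,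
      ofReal_integral_eq_lintegral_ofReal]
    · exact (Continuous.integrableOn_Icc (by fun_prop)).mono_set Ioo_subset_Icc_self
    · exact (ae_restrict_iff' measurableSet_Ioo).2 (Eventually.of_forall fun t ht =>
        mul_nonneg (pow_nonneg ht.1.le _) (pow_nonneg (sub_nonneg.2 ht.2.le) _))
  · rw [indicator_of_notMem hr, lintegral_eq_zero_iff (by fun_prop)]
    refine Eventually.of_forall fun t => ?_
    by_cases h1 : 0 < t
    · have : ¬ t < r := fun h => hr (h1.trans h)
      simp [F, indicator, this]
    · simp [F, indicator, h1]

theorem lintegral_pi_Ioi_succ {n : ℕ} {f : (Fin (n + 1) → ℝ) → ℝ≥0∞} (hf : Measurable f) :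
    ∫⁻ x in univ.pi fun _ : Fin (n + 1) => Ioi (0 : ℝ), f x =
      ∫⁻ t in Ioi (0 : ℝ), ∫⁻ y in univ.pi fun _ : Fin n => Ioi (0 : ℝ), f (Fin.cons t y) := by
  simp_rw [volume_pi, Measure.restrict_pi_pi]
  have h := measurePreserving_piFinSuccAbove
    (fun _ : Fin (n + 1) => (volume : Measure ℝ).restrict (Ioi 0)) 0
  rw [← h.symm.lintegral_comp_emb (MeasurableEquiv.measurableEmbedding _), lintegral_prod]
  · simp [MeasurableEquiv.piFinSuccAbove_symm_apply, Fin.insertNthEquiv]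
  · exact (hf.comp (MeasurableEquiv.measurable _)).aemeasurable

/-- Dirichlet's formula: split off the first coordinate `t`, use induction for the shifted function
`g (t + ·)`, and merge the two remaining integrals. -/
theorem lintegral_pi_Ioi_prod_pow_mul_comp_sum (n : ℕ) (α : Fin (n + 1) → ℕ) {g : ℝ → ℝ≥0∞}
    (hg : Measurable g) :
    ∫⁻ x in univ.pi fun _ : Fin (n + 1) => Ioi (0 : ℝ),
        ENNReal.ofReal (∏ i, x i ^ α i) * g (∑ i, x i) =
      ENNReal.ofReal ((∏ i, ((α i).factorial : ℝ)) / (n + ∑ i, α i).factorial) *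
        ∫⁻ s in Ioi (0 : ℝ), ENNReal.ofReal (s ^ (n + ∑ i, α i)) * g s := by
  induction n generalizing g with
  | zero =>
    rw [lintegral_pi_Ioi_succ (by fun_prop)]
    have h : ((α 0).factorial : ℝ) / (α 0).factorial = 1 := div_self (by positivity)
    simp [volume_pi, Measure.restrict_pi_pi, h]
  | succ n ih =>
    rw [lintegral_pi_Ioi_succ (by fun_prop)]
    have h : ∀ t ∈ Ioi (0 : ℝ), ∫⁻ y in univ.pi fun _ : Fin (n + 1) => Ioi (0 : ℝ),
        ENNReal.ofReal (∏ i, (Fin.cons t y : Fin (n + 2) → ℝ) i ^ α i) *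
          g (∑ i, (Fin.cons t y : Fin (n + 2) → ℝ) i) =
        ENNReal.ofReal ((∏ i : Fin (n + 1), ((α i.succ).factorial : ℝ)) /
            (n + ∑ i : Fin (n + 1), α i.succ).factorial) * (ENNReal.ofReal (t ^ α 0) *
          ∫⁻ s in Ioi (0 : ℝ), ENNReal.ofReal (s ^ (n + ∑ i : Fin (n + 1), α i.succ)) *
            g (t + s)) := by
      intro t ht
      have ht0 : (0 : ℝ) < t := ht
      rw [mul_left_comm, ← ih (fun i => α i.succ) (g := fun s => g (t + s)) (by fun_prop),
        ← lintegral_const_mul' _ _ ENNReal.ofReal_ne_top]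
      refine lintegral_congr fun y => ?_
      rw [Fin.prod_univ_succ, Fin.sum_univ_succ]
      simp only [Fin.cons_zero, Fin.cons_succ]
      rw [ENNReal.ofReal_mul (by positivity), mul_assoc]
    rw [setLIntegral_congr_fun measurableSet_Ioi h,
      lintegral_const_mul' _ _ ENNReal.ofReal_ne_top,
      lintegral_pow_mul_lintegral_pow_mul _ _ hg, ← mul_assoc,
      ← ENNReal.ofReal_mul (by positivity), Fin.sum_univ_succ α,
      Fin.prod_univ_succ fun i => ((α i).factorial : ℝ)]
    have e : α 0 + (n + ∑ i : Fin (n + 1), α i.succ) + 1 =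
      n + 1 + (α 0 + ∑ i : Fin (n + 1), α i.succ) := by ring
    rw [e]
    congr 2
    field_simp

/-! ### Gaussian moments and the weight on the orthant -/

/-- The half-line moments of the Gaussian weight. -/
noncomputable def gaussianMoment (k : ℕ) : ℝ :=
  ∫ s in Ioi (0 : ℝ), s ^ k * Real.exp (-s ^ 2 / 2)

theorem gaussianMoment_eq (k : ℕ) :
    gaussianMoment k = 2 ^ (((k : ℝ) - 1) / 2) * Real.Gamma (((k : ℝ) + 1) / 2) := by
  have h := integral_rpow_mul_exp_neg_mul_rpow (p := 2) (q := k) (b := 1 / 2) (by norm_num)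
    (by linarith [(Nat.cast_nonneg k : (0 : ℝ) ≤ k)]) (by norm_num)
  have h2 : gaussianMoment k =
      ∫ x in Ioi (0 : ℝ), x ^ (k : ℝ) * Real.exp (-(1 / 2) * x ^ (2 : ℝ)) := by
    refine setIntegral_congr_fun measurableSet_Ioi fun x _ => ?_
    simp only [Real.rpow_natCast, Real.rpow_two]
    congr 2
    ring
  rw [h2, h, show ((1 : ℝ) / 2) = 2⁻¹ by norm_num, Real.inv_rpow (by norm_num),
    ← Real.rpow_neg (by norm_num), neg_div, neg_neg]
  congr 1
  rw [← Real.rpow_neg_one, ← Real.rpow_add (by norm_num)]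
  congr 1
  ring

theorem gaussianMoment_pos (k : ℕ) : 0 < gaussianMoment k := by
  rw [gaussianMoment_eq]
  have := Real.Gamma_pos_of_pos (s := ((k : ℝ) + 1) / 2) (by positivity)
  positivity

theorem gaussianMoment_add_two (k : ℕ) :
    gaussianMoment (k + 2) = (k + 1) * gaussianMoment k := by
  rw [gaussianMoment_eq, gaussianMoment_eq]
  push_cast
  have e1 : ((k : ℝ) + 2 + 1) / 2 = (k + 1) / 2 + 1 := by ring
  have e2 : ((k : ℝ) + 2 - 1) / 2 = (k - 1) / 2 + 1 := by ring
  rw [e1, e2, Real.Gamma_add_one (by positivity), Real.rpow_add_one (by norm_num)]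
  ring

theorem integrableOn_gaussianMoment (k : ℕ) :
    IntegrableOn (fun s : ℝ => s ^ k * Real.exp (-s ^ 2 / 2)) (Ioi 0) := by
  have h := gaussianMoment_pos k
  rw [gaussianMoment] at h
  by_contra hn
  -- A non-integrable function has integral 0 by convention, contradicting positivity.
  rw [integral_undef hn] at h
  exact lt_irrefl _ h

/-- The open positive orthant. -/
def posOrthant (n : ℕ) : Set (Fin n → ℝ) := univ.pi fun _ => Ioi 0

theorem measurableSet_posOrthant (n : ℕ) : MeasurableSet (posOrthant n) :=
  MeasurableSet.univ_pi fun _ => measurableSet_Ioi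

/-- The weight `exp (-(∑ xᵢ)² / 2)`. -/
noncomputable def sumWeight {n : ℕ} (x : Fin n → ℝ) : ℝ := Real.exp (-(∑ i, x i) ^ 2 / 2)

theorem lintegral_monomial_mul_sumWeight (n : ℕ) (α : Fin (n + 1) → ℕ) :
    ∫⁻ x in posOrthant (n + 1), ENNReal.ofReal ((∏ i, x i ^ α i) * sumWeight x) =
      ENNReal.ofReal ((∏ i, ((α i).factorial : ℝ)) / (n + ∑ i, α i).factorial *
        gaussianMoment (n + ∑ i, α i)) := by
  have h := lintegral_pi_Ioi_prod_pow_mul_comp_sum n α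
    (g := fun s => ENNReal.ofReal (Real.exp (-s ^ 2 / 2))) (by fun_prop)
  rw [ENNReal.ofReal_mul (by positivity), gaussianMoment,
    ofReal_integral_eq_lintegral_ofReal (integrableOn_gaussianMoment _)
      ((ae_restrict_iff' measurableSet_Ioi).2 (Eventually.of_forall fun t (ht : 0 < t) =>
        by positivity))]
  convert h using 2
  · rfl
  · refine funext fun x => ?_
    exact ENNReal.ofReal_mul' (Real.exp_pos _).le
  · refine setLIntegral_congr_fun measurableSet_Ioi fun s (hs : 0 < s) => ?_
    exact ENNReal.ofReal_mul (by positivity)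

theorem measurable_monomial_mul_sumWeight {n : ℕ} (α : Fin n → ℕ) :
    Measurable fun x : Fin n → ℝ => (∏ i, x i ^ α i) * sumWeight x := by
  unfold sumWeight
  fun_prop

theorem ae_nonneg_monomial_mul_sumWeight {n : ℕ} (α : Fin n → ℕ) :
    0 ≤ᵐ[volume.restrict (posOrthant n)] fun x => (∏ i, x i ^ α i) * sumWeight x :=
  (ae_restrict_iff' (measurableSet_posOrthant n)).2 (Eventually.of_forall fun _ hx =>
    mul_nonneg (Finset.prod_nonneg fun i _ => pow_nonneg (le_of_lt (hx i (mem_univ i))) _)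
      (Real.exp_pos _).le)

theorem integrableOn_monomial_mul_sumWeight {n : ℕ} (α : Fin (n + 1) → ℕ) :
    IntegrableOn (fun x => (∏ i, x i ^ α i) * sumWeight x) (posOrthant (n + 1)) := by
  refine ⟨(measurable_monomial_mul_sumWeight α).aestronglyMeasurable, ?_⟩
  rw [hasFiniteIntegral_iff_ofReal (ae_nonneg_monomial_mul_sumWeight α),
    lintegral_monomial_mul_sumWeight]
  exact ENNReal.ofReal_lt_top

theorem integral_monomial_mul_sumWeight {n : ℕ} (α : Fin (n + 1) → ℕ) :
    ∫ x in posOrthant (n + 1), (∏ i, x i ^ α i) * sumWeight x =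
      (∏ i, ((α i).factorial : ℝ)) / (n + ∑ i, α i).factorial *
        gaussianMoment (n + ∑ i, α i) := by
  rw [integral_eq_lintegral_of_nonneg_ae (ae_nonneg_monomial_mul_sumWeight α)
    (measurable_monomial_mul_sumWeight α).aestronglyMeasurable,
    lintegral_monomial_mul_sumWeight, ENNReal.toReal_ofReal]
  have := gaussianMoment_pos (n + ∑ i, α i)
  positivity

/-! ### Pointwise comparison of the product with the weight -/

theorem sq_sum_eq_add_two_mul_sum_orderedPairs {n : ℕ} (f : Fin n → ℝ) :
    (∑ i, f i) ^ 2 = ∑ i, f i ^ 2 + 2 * ∑ e ∈ orderedPairs n, f e.1 * f e.2 := by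
  have h : ∑ e ∈ orderedPairs n, f e.1 * f e.2 =
      ∑ i, ∑ j, if i < j then f i * f j else 0 := by
    rw [orderedPairs, Finset.sum_filter, Fintype.sum_prod_type]
  have h' : ∑ e ∈ orderedPairs n, f e.1 * f e.2 =
      ∑ i, ∑ j, if j < i then f i * f j else 0 := by
    rw [h, Finset.sum_comm]
    simp_rw [mul_comm]
  rw [two_mul]
  nth_rw 1 [h]
  rw [h', ← Finset.sum_add_distrib, ← Finset.sum_add_distrib, sq, Finset.sum_mul_sum]
  refine Finset.sum_congr rfl fun i _ => ?_
  have hd : f i ^ 2 = ∑ j, if i = j then f i * f j else 0 := by simp [sq]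
  rw [hd, ← Finset.sum_add_distrib, ← Finset.sum_add_distrib]
  refine Finset.sum_congr rfl fun j _ => ?_
  rcases lt_trichotomy i j with h | h | h
  · simp [h, h.ne, h.not_gt]
  · simp [h]
  · simp [h, h.ne', h.not_gt]

theorem two_mul_card_orderedPairs (n : ℕ) : 2 * ((orderedPairs n).card : ℝ) = n ^ 2 - n := by
  have h := sq_sum_eq_add_two_mul_sum_orderedPairs (n := n) fun _ => 1
  simp only [Finset.sum_const, Finset.card_univ, Fintype.card_fin, one_pow, mul_one,
    nsmul_eq_mul] at h
  linarith

theorem one_sub_le_exp_neg_sub_sq_div_two {y : ℝ} (h0 : 0 ≤ y) (h1 : y ≤ 1) :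
    1 - y ≤ Real.exp (-y - y ^ 2 / 2) := by
  rcases h1.eq_or_lt with rfl | h1
  · simpa using (Real.exp_pos _).le
  rw [← Real.log_le_iff_le_exp (by linarith)]
  have h := Real.hasSum_pow_div_log_of_abs_lt_one (x := y) (by rwa [abs_of_nonneg h0])
  have h2 := sum_le_hasSum (Finset.range 2) (fun i _ => by positivity) h
  norm_num [Finset.sum_range_succ] at h2
  linarith

theorem exp_neg_sub_sq_sub_cube_le_one_sub {y : ℝ} (h0 : 0 ≤ y) (h1 : y ≤ 1 / 2) :
    Real.exp (-y - y ^ 2 / 2 - 2 * y ^ 3) ≤ 1 - y := by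
  rw [← Real.le_log_iff_exp_le (by linarith)]
  have h := Real.abs_log_sub_add_sum_range_le (x := y) (by rw [abs_of_nonneg h0]; linarith) 2
  rw [abs_of_nonneg h0] at h
  have h3 : y ^ (2 + 1) / (1 - y) ≤ 2 * y ^ 3 := by
    rw [div_le_iff₀ (by linarith)]
    have : 0 ≤ y ^ 3 * (1 - 2 * y) := mul_nonneg (pow_nonneg h0 3) (by linarith)
    rw [show y ^ (2 + 1) = y ^ 3 from rfl]
    linarith
  have h2 := neg_le_of_abs_le (h.trans h3)
  norm_num [Finset.sum_range_succ] at h2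
  linarith

theorem abs_exp_sub_one_le_two_mul {a h b : ℝ} (ha : h - b ≤ a) (ha' : a ≤ h) (hh : h ≤ 9 / 16) : |Real.exp a - 1| ≤ 2 * (|h| + b) := by
  have h1 : Real.exp (9 / 16) ≤ 2 := by
    rw [← Real.le_log_iff_exp_le (by norm_num)]
    linarith [Real.log_two_gt_d9]
  have h2 := Real.add_one_le_exp a
  have h3 := Real.add_one_le_exp (-a)
  have h4 : Real.exp a * Real.exp (-a) = 1 := by rw [← Real.exp_add]; simp
  have h5 : Real.exp a ≤ 2 := (Real.exp_le_exp.2 (ha'.trans hh)).trans h1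
  have h6 := Real.exp_pos a
  have h7 : a ≤ |h| := ha'.trans (le_abs_self h)
  have h8 := neg_abs_le h
  have h9 := abs_nonneg h
  rw [abs_le]
  constructor
  · linarith
  · have : Real.exp a - 1 ≤ Real.exp a * a := by nlinarith
    nlinarith

/-- If all coordinates are at most 1/2, second-order bounds for `log (1 - y)` control the ratio to
the weight. Otherwise the error is at most the weight itself, and the fourth powers absorb it. The
parameter `c` splits `U(2-U)` by AM–GM into terms with computable means. -/
theorem abs_indicator_unitCube_sub_sumWeight_le {n : ℕ} {x : Fin n → ℝ} (hx : x ∈ posOrthant n)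
    {c : ℝ} (hc : 0 < c) :
    |(unitCube n).indicator (fun x => ∏ e ∈ orderedPairs n, (1 - x e.1 * x e.2)) x -
        sumWeight x| ≤
      (17 * ∑ i, x i ^ 4 + 4 * ∑ e ∈ orderedPairs n, (x e.1 ^ 3 * x e.2 ^ 3) +
        (c * (2 - ∑ i, x i ^ 2) ^ 2 + c⁻¹ * (∑ i, x i ^ 2) ^ 2) / 4) * sumWeight x := by
  have hpos : ∀ i, 0 < x i := fun i => hx i (mem_univ i)
  have hw : 0 < sumWeight x := Real.exp_pos _
  have hT : 0 ≤ ∑ e ∈ orderedPairs n, (x e.1 ^ 3 * x e.2 ^ 3) :=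
    Finset.sum_nonneg fun e _ => by have := hpos e.1; have := hpos e.2; positivity
  have hW : 0 ≤ ∑ i, x i ^ 4 := Finset.sum_nonneg fun i _ => by positivity
  have hU : 0 ≤ ∑ i, x i ^ 2 := Finset.sum_nonneg fun i _ => by positivity
  have hs := sq_sum_eq_add_two_mul_sum_orderedPairs x
  have hs2 := sq_sum_eq_add_two_mul_sum_orderedPairs fun i => x i ^ 2
  simp only [← pow_mul, Nat.reduceMul] at hs2
  set U := ∑ i, x i ^ 2 with hUdef
  set W := ∑ i, x i ^ 4 with hWdef
  set T := ∑ e ∈ orderedPairs n, (x e.1 ^ 3 * x e.2 ^ 3) with hTdef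
  set P := ∏ e ∈ orderedPairs n, (1 - x e.1 * x e.2) with hP
  have hcc : c * c⁻¹ = 1 := mul_inv_cancel₀ hc.ne'
  have hci : 0 < c⁻¹ := inv_pos.2 hc
  have hK : 0 ≤ (c * (2 - U) ^ 2 + c⁻¹ * U ^ 2) / 4 := by positivity
  have hAM : |U * (2 - U)| / 2 ≤ (c * (2 - U) ^ 2 + c⁻¹ * U ^ 2) / 4 := by
    have h1 : 0 ≤ c * ((2 - U) - c⁻¹ * U) ^ 2 := by positivity
    have h2 : 0 ≤ c * ((2 - U) + c⁻¹ * U) ^ 2 := by positivity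
    have e1 : c * ((2 - U) - c⁻¹ * U) ^ 2 =
        c * (2 - U) ^ 2 + (c * c⁻¹) * c⁻¹ * U ^ 2 - 2 * (c * c⁻¹) * (U * (2 - U)) := by ring
    have e2 : c * ((2 - U) + c⁻¹ * U) ^ 2 =
        c * (2 - U) ^ 2 + (c * c⁻¹) * c⁻¹ * U ^ 2 + 2 * (c * c⁻¹) * (U * (2 - U)) := by ring
    rw [hcc] at e1 e2
    have : |U * (2 - U)| ≤ (c * (2 - U) ^ 2 + c⁻¹ * U ^ 2) / 2 := abs_le.2 ⟨by linarith, by linarith⟩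
    linarith
  have hbig : (∃ i, 1 / 2 < x i) → 1 ≤ 16 * W := by
    rintro ⟨i, hi⟩
    have h1 : x i ^ 4 ≤ W := Finset.single_le_sum (f := fun i => x i ^ 4)
      (fun i _ => by positivity) (Finset.mem_univ i)
    have h2 : (1 / 2 : ℝ) ^ 4 ≤ x i ^ 4 := pow_le_pow_left₀ (by norm_num) hi.le 4
    norm_num at h2
    linarith
  by_cases hcube : x ∈ unitCube n
  · rw [indicator_of_mem hcube, ← hP]
    have hle1 : ∀ i, x i ≤ 1 := fun i => (hcube i (mem_univ i)).2
    have hWU : W ≤ U := Finset.sum_le_sum fun i _ =>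
      pow_le_pow_of_le_one (hpos i).le (hle1 i) (by norm_num)
    -- Since `W ≤ U`, the exponent is at most `(3U - U²)/4`, maximal at `U = 3/2`; the value 9/16 is
    -- below `log 2`.
    have hexp : U / 2 - U ^ 2 / 4 + W / 4 ≤ 9 / 16 := by nlinarith [sq_nonneg (U - 3 / 2)]
    have hup : P ≤ Real.exp (U / 2 - U ^ 2 / 4 + W / 4) * sumWeight x := by
      have h1 : P ≤ ∏ e ∈ orderedPairs n,
          Real.exp (-(x e.1 * x e.2) - (x e.1 * x e.2) ^ 2 / 2) :=
        Finset.prod_le_prod (fun e _ => sub_nonneg.2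
          (mul_le_one₀ (hle1 _) (hpos _).le (hle1 _)))
          fun e _ => one_sub_le_exp_neg_sub_sq_div_two (mul_pos (hpos _) (hpos _)).le
            (mul_le_one₀ (hle1 _) (hpos _).le (hle1 _))
      refine h1.trans_eq ?_
      rw [← Real.exp_sum, sumWeight, ← Real.exp_add]
      congr 1
      rw [Finset.sum_sub_distrib, Finset.sum_neg_distrib, ← Finset.sum_div]
      simp_rw [mul_pow]
      linarith
    have hP0 : 0 ≤ P := Finset.prod_nonneg fun e _ => sub_nonneg.2
      (mul_le_one₀ (hle1 _) (hpos _).le (hle1 _))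
    by_cases hhalf : ∃ i, 1 / 2 < x i
    · have h1 : Real.exp (U / 2 - U ^ 2 / 4 + W / 4) ≤ 2 := by
        have h2 : Real.exp (9 / 16) ≤ 2 := by
          rw [← Real.le_log_iff_exp_le (by norm_num)]
          linarith [Real.log_two_gt_d9]
        exact (Real.exp_le_exp.2 hexp).trans h2
      have h2 : P ≤ 2 * sumWeight x := hup.trans (mul_le_mul_of_nonneg_right h1 hw.le)
      have h3 : |P - sumWeight x| ≤ 1 * sumWeight x := abs_le.2 ⟨by linarith, by linarith⟩
      refine h3.trans (mul_le_mul_of_nonneg_right ?_ hw.le)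
      linarith [hbig hhalf]
    · push Not at hhalf
      have hy : ∀ i j, x i * x j ≤ 1 / 2 := fun i j => by
        nlinarith [hhalf i, hhalf j, hpos i, hpos j]
      have hlow : Real.exp (U / 2 - U ^ 2 / 4 + W / 4 - 2 * T) * sumWeight x ≤ P := by
        have h1 : ∏ e ∈ orderedPairs n, Real.exp (-(x e.1 * x e.2) -
            (x e.1 * x e.2) ^ 2 / 2 - 2 * (x e.1 * x e.2) ^ 3) ≤ P :=
          Finset.prod_le_prod (fun e _ => (Real.exp_pos _).le) fun e _ =>
            exp_neg_sub_sq_sub_cube_le_one_sub (mul_pos (hpos _) (hpos _)).le (hy _ _)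
        refine Eq.trans_le ?_ h1
        rw [← Real.exp_sum, sumWeight, ← Real.exp_add]
        congr 1
        rw [Finset.sum_sub_distrib, Finset.sum_sub_distrib, Finset.sum_neg_distrib,
          ← Finset.sum_div, ← Finset.mul_sum]
        simp_rw [mul_pow]
        linarith
      have hPpos : 0 < P := (mul_pos (Real.exp_pos _) hw).trans_le hlow
      have hq : 0 < P / sumWeight x := div_pos hPpos hw
      have key := abs_exp_sub_one_le_two_mul (a := Real.log (P / sumWeight x))
        (h := U / 2 - U ^ 2 / 4 + W / 4) (b := 2 * T)
        ((Real.le_log_iff_exp_le hq).2 ((le_div_iff₀ hw).2 hlow))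
        ((Real.log_le_iff_le_exp hq).2 ((div_le_iff₀ hw).2 hup)) hexp
      rw [Real.exp_log hq] at key
      have e : |P - sumWeight x| = |P / sumWeight x - 1| * sumWeight x := by
        rw [← abs_of_pos hw, ← abs_mul, abs_of_pos hw, sub_mul, div_mul_cancel₀ _ hw.ne', one_mul]
      rw [e]
      refine mul_le_mul_of_nonneg_right (key.trans ?_) hw.le
      have h1 : |U / 2 - U ^ 2 / 4 + W / 4| ≤ |U * (2 - U)| / 4 + W / 4 := by
        have : U / 2 - U ^ 2 / 4 + W / 4 = U * (2 - U) / 4 + W / 4 := by ring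
        rw [this]
        refine (abs_add_le _ _).trans_eq ?_
        rw [abs_div, abs_div, abs_of_nonneg hW, abs_of_pos (by norm_num : (0 : ℝ) < 4)]
      linarith
  · rw [indicator_of_notMem hcube, zero_sub, abs_neg, abs_of_pos hw]
    refine le_mul_of_one_le_left hw.le ?_
    have : ∃ i, 1 / 2 < x i := by
      by_contra! h
      exact hcube fun i _ => ⟨hpos i, (h i).trans (by norm_num)⟩
    linarith [hbig this]

/-! ### Moments under the normalised weight -/

/-- The total mass of the weight `sumWeight` on the positive orthant of dimension `n + 1`. -/
noncomputable def orthantMass (n : ℕ) : ℝ := gaussianMoment n / n.factorial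

theorem orthantMass_pos (n : ℕ) : 0 < orthantMass n :=
  div_pos (gaussianMoment_pos n) (by positivity)

/-- The function `f` is integrable for the normalised weight `sumWeight`, with mean `m`. -/
def HasOrthantMean {n : ℕ} (f : (Fin (n + 1) → ℝ) → ℝ) (m : ℝ) : Prop :=
  IntegrableOn (fun x => f x * sumWeight x) (posOrthant (n + 1)) ∧
    ∫ x in posOrthant (n + 1), f x * sumWeight x = m * orthantMass n

namespace HasOrthantMean

variable {n : ℕ} {f g : (Fin (n + 1) → ℝ) → ℝ} {a b : ℝ}

theorem add (hf : HasOrthantMean f a) (hg : HasOrthantMean g b) :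
    HasOrthantMean (fun x => f x + g x) (a + b) := by
  unfold HasOrthantMean
  simp_rw [add_mul]
  exact ⟨hf.1.add hg.1, by rw [integral_add hf.1 hg.1, hf.2, hg.2]⟩

theorem const_mul (c : ℝ) (hf : HasOrthantMean f a) :
    HasOrthantMean (fun x => c * f x) (c * a) := by
  unfold HasOrthantMean
  simp_rw [mul_assoc]
  exact ⟨hf.1.const_mul c, by rw [integral_const_mul, hf.2]⟩

theorem sum {ι : Type*} {s : Finset ι} {F : ι → (Fin (n + 1) → ℝ) → ℝ}
    (hF : ∀ i ∈ s, HasOrthantMean (F i) a) :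
    HasOrthantMean (fun x => ∑ i ∈ s, F i x) (s.card * a) := by
  unfold HasOrthantMean
  simp_rw [Finset.sum_mul]
  refine ⟨integrable_finsetSum _ fun i hi => (hF i hi).1, ?_⟩
  rw [integral_finsetSum _ fun i hi => (hF i hi).1, Finset.sum_congr rfl fun i hi => (hF i hi).2,
    Finset.sum_const, nsmul_eq_mul, mul_assoc]

end HasOrthantMean

theorem hasOrthantMean_monomial {n : ℕ} (α : Fin (n + 1) → ℕ) {k : ℕ} (hk : ∑ i, α i = k) {m : ℝ}
    (hm : (∏ i, ((α i).factorial : ℝ)) * gaussianMoment (n + k) * n.factorial =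
      m * gaussianMoment n * (n + k).factorial) :
    HasOrthantMean (fun x => ∏ i, x i ^ α i) m := by
  refine ⟨integrableOn_monomial_mul_sumWeight α, ?_⟩
  rw [integral_monomial_mul_sumWeight, hk, orthantMass, div_mul_eq_mul_div, mul_div_assoc',
    div_eq_div_iff (by positivity) (by positivity), hm]

theorem hasOrthantMean_one (n : ℕ) : HasOrthantMean (n := n) (fun _ => 1) 1 := by
  simpa using hasOrthantMean_monomial (n := n) (fun _ => 0) (k := 0) (m := 1) (by simp) (by simp)

theorem hasOrthantMean_pow {n : ℕ} (i : Fin (n + 1)) (k : ℕ) {m : ℝ}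
    (hm : (k.factorial : ℝ) * gaussianMoment (n + k) * n.factorial =
      m * gaussianMoment n * (n + k).factorial) :
    HasOrthantMean (fun x => x i ^ k) m := by
  have h : ∀ x : Fin (n + 1) → ℝ, ∏ j, x j ^ (Pi.single i k : Fin (n + 1) → ℕ) j = x i ^ k :=
    fun x => by
      rw [Finset.prod_eq_single i (fun j _ hj => by simp [hj]) (by simp)]
      simp
  have hf : ∏ j, (((Pi.single i k : Fin (n + 1) → ℕ) j).factorial : ℝ) = k.factorial := by
    rw [Finset.prod_eq_single i (fun j _ hj => by simp [hj]) (by simp)]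
    simp
  have := hasOrthantMean_monomial (Pi.single i k) (k := k) (m := m) (by simp) (by rw [hf, hm])
  simpa only [h] using this

theorem hasOrthantMean_pow_mul_pow {n : ℕ} {i j : Fin (n + 1)} (hij : i ≠ j) (k : ℕ) {m : ℝ}
    (hm : (k.factorial : ℝ) * k.factorial * gaussianMoment (n + (k + k)) * n.factorial =
      m * gaussianMoment n * (n + (k + k)).factorial) :
    HasOrthantMean (fun x => x i ^ k * x j ^ k) m := by
  set α : Fin (n + 1) → ℕ := fun l => if l = i ∨ l = j then k else 0 with hα
  have h : ∀ x : Fin (n + 1) → ℝ, ∏ l, x l ^ α l = x i ^ k * x j ^ k := fun x => by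
    rw [Finset.prod_eq_mul i j hij (fun l _ hl => by simp [hα, hl.1, hl.2]) (by simp) (by simp)]
    simp [hα]
  have hf : ∏ l, ((α l).factorial : ℝ) = k.factorial * k.factorial := by
    rw [Finset.prod_eq_mul i j hij (fun l _ hl => by simp [hα, hl.1, hl.2]) (by simp) (by simp)]
    simp [hα]
  have hs : ∑ l, α l = k + k := by
    rw [Finset.sum_eq_add i j hij (fun l _ hl => by simp [hα, hl.1, hl.2]) (by simp) (by simp)]
    simp [hα]
  have := hasOrthantMean_monomial α (m := m) hs (by rw [hf, hm])
  simpa only [h] using this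

/-- The moment recursion supplies `n+1`, which cancels against `(n+2)!/n!` and leaves only `n+2`.
The analogues of orders four and six work alike. -/
theorem gaussianMoment_add_two_mul_factorial (n : ℕ) {m : ℝ} (a : ℝ)
    (h : m * (n + 2) = a) :
    a * gaussianMoment (n + 2) * n.factorial = m * gaussianMoment n * (n + 2).factorial := by
  rw [gaussianMoment_add_two, Nat.factorial_succ, Nat.factorial_succ, ← h]
  push_cast
  ring

theorem gaussianMoment_add_four_mul_factorial (n : ℕ) {m : ℝ} (a : ℝ)
    (h : m * ((n + 2) * (n + 4)) = a) :
    a * gaussianMoment (n + 4) * n.factorial = m * gaussianMoment n * (n + 4).factorial := by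
  rw [show n + 4 = n + 2 + 2 by ring, gaussianMoment_add_two (n + 2), gaussianMoment_add_two,
    Nat.factorial_succ, Nat.factorial_succ, Nat.factorial_succ, Nat.factorial_succ, ← h]
  push_cast
  ring

theorem gaussianMoment_add_six_mul_factorial (n : ℕ) {m : ℝ} (a : ℝ)
    (h : m * ((n + 2) * (n + 4) * (n + 6)) = a) :
    a * gaussianMoment (n + 6) * n.factorial = m * gaussianMoment n * (n + 6).factorial := by
  rw [show n + 6 = n + 2 + 2 + 2 by ring, gaussianMoment_add_two (n + 2 + 2),
    gaussianMoment_add_two (n + 2), gaussianMoment_add_two,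
    Nat.factorial_succ, Nat.factorial_succ, Nat.factorial_succ, Nat.factorial_succ,
    Nat.factorial_succ, Nat.factorial_succ, ← h]
  push_cast
  ring

theorem hasOrthantMean_errorBound (n : ℕ) (c : ℝ) :
    HasOrthantMean (n := n) (fun x =>
      17 * ∑ i, x i ^ 4 + 4 * ∑ e ∈ orderedPairs (n + 1), (x e.1 ^ 3 * x e.2 ^ 3) +
        (c * (2 - ∑ i, x i ^ 2) ^ 2 + c⁻¹ * (∑ i, x i ^ 2) ^ 2) / 4)
      (408 * (n + 1) / ((n + 2) * (n + 4)) +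
        72 * (n + 1) * n / ((n + 2) * (n + 4) * (n + 6)) +
        (c * (12 / (n + 4)) + c⁻¹ * ((4 * (n + 1) ^ 2 + 20 * (n + 1)) / ((n + 2) * (n + 4)))) / 4)
      := by
  have hlt : ∀ e ∈ orderedPairs (n + 1), e.1 ≠ e.2 := fun e he =>
    ne_of_lt (by simpa [orderedPairs] using he)
  have hU : HasOrthantMean (n := n) (fun x => ∑ i, x i ^ 2) _ := HasOrthantMean.sum fun i _ =>
    hasOrthantMean_pow i 2 (m := 2 / (n + 2)) (gaussianMoment_add_two_mul_factorial n _
      (by simp [Nat.factorial]; field_simp))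
  have hW : HasOrthantMean (n := n) (fun x => ∑ i, x i ^ 4) _ := HasOrthantMean.sum fun i _ =>
    hasOrthantMean_pow i 4 (m := 24 / ((n + 2) * (n + 4)))
      (gaussianMoment_add_four_mul_factorial n _ (by norm_num [Nat.factorial]; field_simp))
  have hV : HasOrthantMean (n := n)
      (fun x => ∑ e ∈ orderedPairs (n + 1), x e.1 ^ 2 * x e.2 ^ 2) _ :=
    HasOrthantMean.sum fun e he =>
      hasOrthantMean_pow_mul_pow (hlt e he) 2 (m := 4 / ((n + 2) * (n + 4)))
        (gaussianMoment_add_four_mul_factorial n _ (by norm_num [Nat.factorial]; field_simp))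
  have hT : HasOrthantMean (n := n)
      (fun x => ∑ e ∈ orderedPairs (n + 1), x e.1 ^ 3 * x e.2 ^ 3) _ :=
    HasOrthantMean.sum fun e he =>
      hasOrthantMean_pow_mul_pow (hlt e he) 3 (m := 36 / ((n + 2) * (n + 4) * (n + 6)))
        (gaussianMoment_add_six_mul_factorial n _ (by norm_num [Nat.factorial]; field_simp))
  -- The last term of the bound is `c - cU + ((c + c⁻¹)/4)U²`, where `U²` is the sum of fourth
  -- powers plus twice the sum over pairs.
  have h := ((hW.const_mul (17 + (c + c⁻¹) / 4)).add (hT.const_mul 4)).add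
    (((hV.const_mul ((c + c⁻¹) / 2)).add (hU.const_mul (-c))).add
      ((hasOrthantMean_one n).const_mul c))
  have hcard : ((orderedPairs (n + 1)).card : ℝ) = (n + 1) * n / 2 := by
    have := two_mul_card_orderedPairs (n + 1)
    push_cast at this
    linarith
  rw [hcard, Finset.card_univ, Fintype.card_fin] at h
  convert h using 1
  · refine funext fun x => ?_
    have hs := sq_sum_eq_add_two_mul_sum_orderedPairs fun i => x i ^ 2
    simp only [← pow_mul, Nat.reduceMul] at hs
    linear_combination ((c + c⁻¹) / 4) * hs
  · push_cast
    field_simp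
    ring

theorem abs_card_exchangeFree_div_sub_orthantMass_le (n : ℕ) :
    |((exchangeFree (n + 1)).card : ℝ) / ((n + 1).factorial : ℝ) ^ (n + 1) - orthantMass n| ≤
      485 * (√((n : ℝ) + 1))⁻¹ * orthantMass n := by
  -- The mean of `(2-U)²` is of order `1/n` and that of `U²` is bounded, so this `c` balances them.
  -- The constant is `408 + 72 + (12+5)/4 ≤ 485`.
  set c : ℝ := √((n : ℝ) + 1) with hc
  have hcpos : 0 < c := Real.sqrt_pos.2 (by positivity)
  have hc2 : c ^ 2 = n + 1 := Real.sq_sqrt (by positivity)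
  have hc1 : 1 ≤ c := Real.one_le_sqrt.2 (by linarith [(Nat.cast_nonneg n : (0 : ℝ) ≤ n)])
  obtain ⟨h1, h2⟩ := hasOrthantMean_one n
  obtain ⟨h3, h4⟩ := hasOrthantMean_errorBound n c
  simp only [one_mul] at h1 h2
  have hsub : unitCube (n + 1) ⊆ posOrthant (n + 1) := pi_mono fun _ _ => Ioc_subset_Ioi_self
  set F : (Fin (n + 1) → ℝ) → ℝ := fun x => ∏ e ∈ orderedPairs (n + 1), (1 - x e.1 * x e.2)
    with hF
  have hint : IntegrableOn ((unitCube (n + 1)).indicator F) (posOrthant (n + 1)) := by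
    rw [IntegrableOn, integrable_indicator_iff (measurableSet_unitCube _)]
    have : IntegrableOn F (unitCube (n + 1)) := by
      refine IntegrableOn.mono_set (t := univ.pi fun _ => Icc 0 1) ?_
        (pi_mono fun _ _ => Ioc_subset_Icc_self)
      exact ContinuousOn.integrableOn_compact (isCompact_univ_pi fun _ => isCompact_Icc)
        (Continuous.continuousOn (by fun_prop))
    exact Integrable.mono_measure this (Measure.restrict_mono_measure Measure.restrict_le_self _)
  have hp : ∫ x in posOrthant (n + 1), (unitCube (n + 1)).indicator F x =
      ((exchangeFree (n + 1)).card : ℝ) / ((n + 1).factorial : ℝ) ^ (n + 1) := by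
    rw [card_exchangeFree_div_eq_integral, setIntegral_indicator (measurableSet_unitCube _),
      inter_eq_right.2 hsub]
  rw [← hp, ← h2, ← integral_sub hint h1]
  refine (abs_integral_le_integral_abs).trans ((setIntegral_mono_on (hint.sub h1).abs h3
    (measurableSet_posOrthant _) fun x hx =>
      abs_indicator_unitCube_sub_sumWeight_le hx hcpos).trans ?_)
  rw [h4, h2]
  refine mul_le_mul_of_nonneg_right ?_ (orthantMass_pos n).le
  have hn : (n : ℝ) = c ^ 2 - 1 := by linarith
  have e1 : 408 * ((n : ℝ) + 1) / ((n + 2) * (n + 4)) ≤ 408 * c⁻¹ := by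
    rw [div_le_iff₀ (by positivity), mul_assoc]
    refine mul_le_mul_of_nonneg_left ?_ (by norm_num)
    rw [← div_eq_inv_mul, le_div_iff₀ hcpos, hn]
    nlinarith [pow_pos hcpos 3, mul_le_mul_of_nonneg_right hc1 (pow_pos hcpos 3).le]
  have e2 : 72 * ((n : ℝ) + 1) * n / ((n + 2) * (n + 4) * (n + 6)) ≤ 72 * c⁻¹ := by
    have hn0 : (0 : ℝ) ≤ n := Nat.cast_nonneg n
    have hcn : c ≤ n + 6 := by nlinarith
    rw [div_le_iff₀ (by positivity), mul_assoc, mul_assoc]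
    refine mul_le_mul_of_nonneg_left ?_ (by norm_num)
    rw [← div_eq_inv_mul, le_div_iff₀ hcpos]
    refine mul_le_mul ?_ hcn hcpos.le (by positivity)
    nlinarith
  have e3 : c * (12 / ((n : ℝ) + 4)) ≤ 12 * c⁻¹ := by
    rw [mul_div_assoc', div_le_iff₀ (by positivity), hn]
    have : c⁻¹ * c = 1 := inv_mul_cancel₀ hcpos.ne'
    have e : 12 * c⁻¹ * (c ^ 2 - 1 + 4) = 12 * (c⁻¹ * c) * c + 36 * c⁻¹ := by ring
    rw [e, this]
    have := inv_pos.2 hcpos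
    linarith
  have e4 : c⁻¹ * ((4 * ((n : ℝ) + 1) ^ 2 + 20 * (n + 1)) / ((n + 2) * (n + 4))) ≤ 5 * c⁻¹ := by
    rw [mul_comm 5]
    refine mul_le_mul_of_nonneg_left ?_ (inv_pos.2 hcpos).le
    rw [div_le_iff₀ (by positivity)]
    nlinarith [(Nat.cast_nonneg n : (0 : ℝ) ≤ n)]
  have := inv_pos.2 hcpos
  linarith

/-! ### Gamma function estimates for the mass -/

/-- Log-convexity at the midpoint of `x` and `x + 1`. -/
theorem Gamma_add_half_sq_le {x : ℝ} (hx : 0 < x) :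
    Real.Gamma (x + 1 / 2) ^ 2 ≤ x * Real.Gamma x ^ 2 := by
  have h := Real.Gamma_mul_add_mul_le_rpow_Gamma_mul_rpow_Gamma (s := x) (t := x + 1)
    (a := 1 / 2) (b := 1 / 2) hx (by linarith) (by norm_num) (by norm_num) (by norm_num)
  have hg := Real.Gamma_pos_of_pos hx
  have hg1 := Real.Gamma_pos_of_pos (show 0 < x + 1 by linarith)
  rw [show 1 / 2 * x + 1 / 2 * (x + 1) = x + 1 / 2 by ring, ← Real.mul_rpow hg.le hg1.le,
    ← Real.sqrt_eq_rpow] at h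
  have h2 := pow_le_pow_left₀ (Real.Gamma_pos_of_pos (show 0 < x + 1 / 2 by linarith)).le h 2
  rw [Real.sq_sqrt (by positivity), Real.Gamma_add_one hx.ne'] at h2
  linarith

theorem exists_factorial_mul_orthantMass_sq (n : ℕ) (hn : 1 ≤ n) :
    ∃ ρ : ℝ, 1 ≤ ρ ∧ ρ ≤ 1 + (√((n : ℝ) + 1))⁻¹ ∧
      (n + 1).factorial * orthantMass n ^ 2 = ρ * √(Real.pi * ((n : ℝ) + 1) / 2) := by
  set s : ℝ := ((n : ℝ) + 1) / 2 with hs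
  have hn1 : (1 : ℝ) ≤ n := by exact_mod_cast hn
  have hs0 : 0 < s := by positivity
  have hg := Real.Gamma_pos_of_pos hs0
  have hg' := Real.Gamma_pos_of_pos (show 0 < s + 1 / 2 by positivity)
  have hup := Gamma_add_half_sq_le hs0
  -- The same inequality at `s - 1/2`; with `hup` it gives `1 ≤ ρ² ≤ s/(s - 1/2)`.
  have hlow : (s - 1 / 2) * Real.Gamma s ^ 2 ≤ Real.Gamma (s + 1 / 2) ^ 2 := by
    have hx : 0 < s - 1 / 2 := by rw [hs]; linarith
    have h1 := Gamma_add_half_sq_le hx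
    have h2 := Real.Gamma_add_one hx.ne'
    rw [show s - 1 / 2 + 1 / 2 = s by ring] at h1
    rw [show s - 1 / 2 + 1 = s + 1 / 2 by ring] at h2
    rw [h2]
    nlinarith
  refine ⟨√s * Real.Gamma s / Real.Gamma (s + 1 / 2), ?_, ?_, ?_⟩
  · rw [le_div_iff₀ hg', one_mul]
    refine le_of_sq_le_sq ?_ (by positivity)
    rwa [mul_pow, Real.sq_sqrt hs0.le]
  · rw [div_le_iff₀ hg']
    have ht : 0 < (√((n : ℝ) + 1))⁻¹ := inv_pos.2 (Real.sqrt_pos.2 (by positivity))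
    refine le_of_sq_le_sq ?_ (by positivity)
    rw [mul_pow, mul_pow, Real.sq_sqrt hs0.le]
    have ht2 : (√((n : ℝ) + 1))⁻¹ ^ 2 * (2 * s) = 1 := by
      rw [inv_pow, Real.sq_sqrt (by positivity), hs]
      field_simp
    set t := (√((n : ℝ) + 1))⁻¹
    have h1 : s ≤ (1 + t) ^ 2 * (s - 1 / 2) := by
      have ht1 : t ^ 2 * 2 ≤ 1 := by
        have : (1 : ℝ) ≤ s := by rw [hs]; linarith
        nlinarith [sq_nonneg t]
      have : t ≤ 1 := by nlinarith
      nlinarith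
    have h2 : 0 ≤ (1 + t) ^ 2 := by positivity
    nlinarith [mul_le_mul_of_nonneg_right h1 (sq_nonneg (Real.Gamma s)),
      mul_le_mul_of_nonneg_left hlow h2]
  -- Legendre duplication trades one factor `Γ(s)` for `n! √π / (2^n Γ(s + 1/2))`.
  · have hd := Real.Gamma_mul_Gamma_add_half s
    have e1 : 2 * s = (n : ℝ) + 1 := by rw [hs]; ring
    have e2 : (1 : ℝ) - (n + 1) = -(n : ℝ) := by ring
    rw [e1, e2, Real.Gamma_nat_eq_factorial, Real.rpow_neg (by norm_num), Real.rpow_natCast] at hd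
    have hss : √s ^ 2 = s := Real.sq_sqrt hs0.le
    have hsp : √(Real.pi * ((n : ℝ) + 1) / 2) = √Real.pi * √s := by
      rw [mul_div_assoc, Real.sqrt_mul Real.pi_pos.le]
    have h2 : ((2 : ℝ) ^ (((n : ℝ) - 1) / 2)) ^ 2 * 2 = 2 ^ n := by
      rw [← Real.rpow_natCast, ← Real.rpow_mul (by norm_num), ← Real.rpow_add_one (by norm_num),
        ← Real.rpow_natCast]
      congr 1
      push_cast
      ring
    rw [hsp, orthantMass, gaussianMoment_eq, Nat.factorial_succ, ← hs]
    have hf : (n.factorial : ℝ) ≠ 0 := by positivity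
    have hd' : Real.Gamma s * Real.Gamma (s + 1 / 2) * 2 ^ n = n.factorial * √Real.pi := by
      rw [hd]
      field_simp
    rw [div_mul_eq_mul_div, eq_div_iff hg'.ne']
    push_cast
    rw [← e1]
    set A : ℝ := 2 ^ (((n : ℝ) - 1) / 2)
    have hL : 2 * s * n.factorial * (A * Real.Gamma s / n.factorial) ^ 2 *
        Real.Gamma (s + 1 / 2) = s * Real.Gamma s *
          (Real.Gamma s * Real.Gamma (s + 1 / 2) * (A ^ 2 * 2)) / n.factorial := by
      field_simp
    rw [hL, h2, hd']
    nth_rw 1 [← hss]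
    field_simp

/-! ### Conclusion -/

theorem mainTheorem1 (σ : ℝ) (hσ : σ < 1 / 3) :
    ∃ ε : ℕ → ℝ, (ε =O[atTop] fun n : ℕ => (n : ℝ) ^ (-σ)) ∧
      ∀ n : ℕ, 1 ≤ n →
        expectedExchangeStable n = (1 + ε n) * Real.sqrt (Real.pi * (n : ℝ) / 2) := by
  refine ⟨fun n => expectedExchangeStable n / √(Real.pi * (n : ℝ) / 2) - 1, ?_, ?_⟩
  -- The constant bounds `(ρ-1)(1+δ)² + 2δ + δ²` when `ρ - 1 ≤ t`, `|δ| ≤ 485t` and `t ≤ 1`.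
  · refine IsBigO.of_bound (486 ^ 2 + 2 * 485 + 485 ^ 2) ?_
    filter_upwards [eventually_ge_atTop 2] with N hN
    obtain ⟨n, rfl⟩ : ∃ n, N = n + 1 := ⟨N - 1, by omega⟩
    obtain ⟨ρ, h1, h2, h3⟩ := exists_factorial_mul_orthantMass_sq n (by omega)
    have hp := abs_card_exchangeFree_div_sub_orthantMass_le n
    have hm := orthantMass_pos n
    have hn1 : (1 : ℝ) ≤ (n : ℝ) + 1 := by linarith [(Nat.cast_nonneg n : (0 : ℝ) ≤ n)]
    have hts : (√((n : ℝ) + 1))⁻¹ ≤ ((n : ℝ) + 1) ^ (-σ) := by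
      rw [Real.sqrt_eq_rpow, ← Real.rpow_neg (by positivity)]
      exact Real.rpow_le_rpow_of_exponent_le hn1 (by linarith)
    have ht1 : (√((n : ℝ) + 1))⁻¹ ≤ 1 := inv_le_one_of_one_le₀ (Real.one_le_sqrt.2 hn1)
    have ht0 : 0 < (√((n : ℝ) + 1))⁻¹ := inv_pos.2 (Real.sqrt_pos.2 (by positivity))
    have hR : 0 < √(Real.pi * ((n : ℝ) + 1) / 2) := Real.sqrt_pos.2 (by positivity)
    rw [expectedExchangeStable_eq]
    push_cast
    set t := (√((n : ℝ) + 1))⁻¹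
    set p := ((exchangeFree (n + 1)).card : ℝ) / ((n + 1).factorial : ℝ) ^ (n + 1)
    set R := √(Real.pi * ((n : ℝ) + 1) / 2)
    obtain ⟨δ, hδ⟩ : ∃ δ, p = orthantMass n * (1 + δ) :=
      ⟨p / orthantMass n - 1, by field_simp; ring⟩
    have hδt : |δ| ≤ 485 * t := by
      rw [hδ, show orthantMass n * (1 + δ) - orthantMass n = δ * orthantMass n by ring, abs_mul,
        abs_of_pos hm] at hp
      exact le_of_mul_le_mul_right hp hm
    have e : (n + 1).factorial * p ^ 2 / R - 1 = (ρ - 1) * (1 + δ) ^ 2 + (2 * δ + δ ^ 2) := by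
      rw [hδ, mul_pow, ← mul_assoc, h3]
      field_simp
      ring
    rw [e, Real.norm_eq_abs, Real.norm_eq_abs, abs_of_pos (by positivity : 0 < ((n : ℝ) + 1) ^ (-σ))]
    refine le_trans ?_ (mul_le_mul_of_nonneg_left hts (by norm_num))
    obtain ⟨hδ1, hδ2⟩ := abs_le.1 hδt
    have hδsq : δ ^ 2 ≤ 485 ^ 2 * t := by nlinarith
    have hsq : (1 + δ) ^ 2 ≤ 486 ^ 2 := by nlinarith
    have hmul : (ρ - 1) * (1 + δ) ^ 2 ≤ t * 486 ^ 2 :=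
      mul_le_mul (by linarith) hsq (sq_nonneg _) ht0.le
    have hmul0 : 0 ≤ (ρ - 1) * (1 + δ) ^ 2 := mul_nonneg (by linarith) (sq_nonneg _)
    rw [abs_le]
    constructor <;> nlinarith [sq_nonneg δ]
  · intro n hn
    have hn0 : (0 : ℝ) < n := by exact_mod_cast hn
    have hR : 0 < √(Real.pi * (n : ℝ) / 2) := Real.sqrt_pos.2 (by positivity)
    field_simp
    ring
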